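/- Let $X$ be a set of finite permutations (in particular, $X$ may be any permutation class, i.e. a set of permutations closed under pattern containment). For a permutation $\pi$ of $\{1,\dots,n\}$, let $G_\pi$ be the permutation graph of $\pi$: its vertex set is $\{1,\dots,n\}$, and $i,j$ are adjacent if and only if $(i-j)(\pi(i)-\pi(j))<0$. Let $\mathcal G_X$ be the class of all graphs isomorphic to $G_\pi$ for some $\pi\in X$. For a finite alphabet $\Sigma$, a set $\mathcal P\subseteq\Sigma^2$ (the decoder) and a word $w=w_1\cdots w_n$ over $\Sigma$, the letter graph $G(\mathcal P,w)$ has vertex set $\{1,\dots,n\}$, with $i<j$ adjacent if and only if $(w_i,w_j)\in\mathcal P$. The lettericity of a graph $G$ is the least $\ell$ such that $G$ is isomorphic to a letter graph over an alphabet of $\ell$ letters, and $G$ is a $k$-letter graph if its lettericity is at most $k$. For a matrix $M$ with entries in $\{0,1,-1\}$, indexed first by column (from left to right) and then by row (from bottom to top), the standard figure of $M$ is the union in $\mathbb R^2$ of the open segments from $(k-1,\ell-1)$ to $(k,\ell)$ for all $k,\ell$ with $M_{k,\ell}=1$ and the open segments from $(k-1,\ell)$ to $(k,\ell-1)$ for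 all $k,\ell$ with $M_{k,\ell}=-1$. The geometric grid class $\mathrm{Geom}(M)$ is the set of all permutations obtained by choosing $n\ge 0$ points of this figure, no two on a common horizontal or vertical line, labelling them $1,\dots,n$ from bottom to top, and reading the labels from left to right. A set of permutations is geometrically griddable if it is contained in the union of finitely many geometric grid classes. Theorem. If every graph in $\mathcal G_X$ is a $2$-letter graph, then $X$ is geometrically griddable. -/

import Mathlib

/-- A (finite) permutation: a length `n` together with a bijection of `{0, …, n-1}`. -/
abbrev FinPerm : Type := (n : ℕ) × Equiv.Perm (Fin n)

/-- A finite graph, with vertex set `{0, …, n-1}` (every finite graph is isomorphic to one of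
these). -/
abbrev FinGraph : Type := (n : ℕ) × SimpleGraph (Fin n)

/-- The permutation graph `G_π`: distinct `i`, `j` are adjacent iff `(i - j) (π i - π j) < 0`. -/
def permGraph {n : ℕ} (π : Equiv.Perm (Fin n)) : SimpleGraph (Fin n) where
  Adj i j := (((i : ℕ) : ℤ) - ((j : ℕ) : ℤ)) * (((π i : ℕ) : ℤ) - ((π j : ℕ) : ℤ)) < 0
  symm := ⟨fun i j h => by
    have e : (((j : ℕ) : ℤ) - ((i : ℕ) : ℤ)) * (((π j : ℕ) : ℤ) - ((π i : ℕ) : ℤ))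
        = (((i : ℕ) : ℤ) - ((j : ℕ) : ℤ)) * (((π i : ℕ) : ℤ) - ((π j : ℕ) : ℤ)) := by ring
    rw [e]; exact h⟩
  loopless := ⟨fun i h => by simp at h⟩

/-- The class of permutation graphs of a set `X` of permutations: all graphs isomorphic to `G_π`
for some `π ∈ X`. -/
def permGraphClass (X : Set FinPerm) : Set FinGraph :=
  {G | ∃ σ ∈ X, Nonempty (G.2 ≃g permGraph σ.2)}

/-- The letter graph `G(P, w)` of the word `w` with decoder `P`: for `i < j`, the vertices `i` and
`j` are adjacent iff `(w i, w j) ∈ P`. -/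
def letterGraph {A : Type} (P : Set (A × A)) {n : ℕ} (w : Fin n → A) : SimpleGraph (Fin n) where
  Adj i j := (i < j ∧ (w i, w j) ∈ P) ∨ (j < i ∧ (w j, w i) ∈ P)
  symm := ⟨fun _ _ h => h.symm⟩
  loopless := ⟨fun i h => by simp at h⟩

/-- `G` is (isomorphic to) a letter graph over an alphabet of `ℓ` letters. -/
def IsLetterGraphOn (ℓ : ℕ) {n : ℕ} (G : SimpleGraph (Fin n)) : Prop :=
  ∃ (P : Set (Fin ℓ × Fin ℓ)) (w : Fin n → Fin ℓ), Nonempty (G ≃g letterGraph P w)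

/-- The lettericity of `G`: the least size of an alphabet over which `G` is a letter graph. -/
noncomputable def lettericity {n : ℕ} (G : SimpleGraph (Fin n)) : ℕ :=
  sInf {ℓ : ℕ | IsLetterGraphOn ℓ G}

/-- Every graph is a letter graph over its own vertex set, so the minimum above is attained. -/
theorem isLetterGraphOn_card {n : ℕ} (G : SimpleGraph (Fin n)) : IsLetterGraphOn n G := by
  refine ⟨{p | G.Adj p.1 p.2}, id, ⟨⟨Equiv.refl _, ?_⟩⟩⟩
  intro i j
  simp only [letterGraph, Equiv.refl_apply, id, Set.mem_ofPred_eq]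
  constructor
  · rintro (⟨_, h⟩ | ⟨_, h⟩)
    · exact h
    · exact h.symm
  · intro h
    rcases lt_or_gt_of_ne h.ne with h' | h'
    · exact Or.inl ⟨h', h⟩
    · exact Or.inr ⟨h', h.symm⟩

/-- A `k`-letter graph is a graph of lettericity at most `k`. -/
def IsKLetterGraph (k : ℕ) {n : ℕ} (G : SimpleGraph (Fin n)) : Prop :=
  lettericity G ≤ k

/-- The standard figure of a `0/±1` matrix `M`, indexed first by column (left to right) and then by
row (bottom to top). Indices start from `0`, so cell `(k, l)` is `[k, k+1] × [l, l+1]`. -/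
def standardFigure {t u : ℕ} (M : Matrix (Fin t) (Fin u) SignType) : Set (ℝ × ℝ) :=
  {p | ∃ (k : Fin t) (l : Fin u),
    (M k l = 1 ∧
      p ∈ openSegment ℝ (((k : ℕ) : ℝ), ((l : ℕ) : ℝ)) (((k : ℕ) : ℝ) + 1, ((l : ℕ) : ℝ) + 1)) ∨
    (M k l = -1 ∧
      p ∈ openSegment ℝ (((k : ℕ) : ℝ), ((l : ℕ) : ℝ) + 1) (((k : ℕ) : ℝ) + 1, ((l : ℕ) : ℝ)))}

/-- The geometric grid class of `M`: the permutations `π` that can be drawn on its standard figure.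
Here `p i` is the `i`-th point from the left and its label is `π i`, so the point labelled `v`
is `p (π.symm v)`; the labels increase from bottom to top. -/
def Geom {t u : ℕ} (M : Matrix (Fin t) (Fin u) SignType) : Set FinPerm :=
  {σ | ∃ p : Fin σ.1 → ℝ × ℝ, (∀ i, p i ∈ standardFigure M) ∧
    StrictMono (fun i => (p i).1) ∧ StrictMono (fun v => (p (σ.2.symm v)).2)}

/-- `X` is geometrically griddable: it is contained in the union of finitely many geometric grid
classes. -/
def GeometricallyGriddable (X : Set FinPerm) : Prop :=
  ∃ S : Set ((d : ℕ × ℕ) × Matrix (Fin d.1) (Fin d.2) SignType), S.Finite ∧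
    X ⊆ ⋃ M ∈ S, Geom M.2

/-! A decoder on two letters makes each letter class a clique or an independent set, with no induced
`2K₂` between the classes. In a permutation graph this means two monotone sequences whose mutual
inversions form a chain graph, and every such configuration fits one of finitely many fixed figures.

If both sequences increase, the absence of `2K₂` makes all inversions have the same class at the
upper left, and then one vertical or horizontal line cuts the configuration into two increasing
pieces (`drawable_of_upperLeft_mem`). Two decreasing sequences reduce to this by reflection, which
complements the inversion graph.

If one sequence increases and the other decreases, a dominating or isolated vertex of the chain
graph gives a centre where they cross. Points of different sequences in adjacent quadrants are then
inverted exactly when the increasing one is nearer the centre, so a linear order realising the chain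
graph supplies distances for drawing on an `X` (`exists_chain_key`, `drawable_of_centre`). -/

/-- Two points of a planar configuration are inverted if one lies to the upper left of the other. -/
def Inverted {V : Type*} (x y : V → ℝ) (i j : V) : Prop :=
  (x i < x j ∧ y j < y i) ∨ (x j < x i ∧ y i < y j)

/-- The configuration `(x, y)` has an order-isomorphic copy on the standard figure of `M`. -/
def Drawable {V : Type*} {t u : ℕ} (M : Matrix (Fin t) (Fin u) SignType) (x y : V → ℝ) : Prop :=
  ∃ p : V → ℝ × ℝ, (∀ i, p i ∈ standardFigure M) ∧
    (∀ i j, x i < x j → (p i).1 < (p j).1) ∧ (∀ i j, y i < y j → (p i).2 < (p j).2)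

/-- The bipartite inversion graph between `A` and its complement contains no induced `2K₂`. -/
def IsChain2 {V : Type*} (x y : V → ℝ) (A : V → Prop) : Prop :=
  ∀ a a' b b', A a → A a' → ¬ A b → ¬ A b' → Inverted x y a b → Inverted x y a' b' →
    Inverted x y a b' ∨ Inverted x y a' b

/-- The points satisfying `A` form an increasing sequence. -/
def IncreasingOn {V : Type*} (x y : V → ℝ) (A : V → Prop) : Prop :=
  ∀ i j, A i → A j → x i < x j → y i < y j

theorem Inverted.symm {V : Type*} {x y : V → ℝ} {i j : V} (h : Inverted x y i j) :
    Inverted x y j i := h.elim Or.inr Or.inl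

theorem inverted_neg {V : Type*} {x y : V → ℝ} (hx : x.Injective) (hy : y.Injective)
    {i j : V} (hij : i ≠ j) : Inverted x (-y) i j ↔ ¬ Inverted x y i j := by
  have h1 : x i ≠ x j := fun h => hij (hx h)
  have h2 : y i ≠ y j := fun h => hij (hy h)
  simp only [Inverted, Pi.neg_apply, neg_lt_neg_iff]
  rcases lt_or_gt_of_ne h1 with h1 | h1 <;> rcases lt_or_gt_of_ne h2 with h2 | h2 <;>
    simp [h1, h2, h1.not_gt, h2.not_gt]

theorem IsChain2.compl {V : Type*} {x y : V → ℝ} {A : V → Prop} (h : IsChain2 x y A) :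
    IsChain2 x y (fun v => ¬ A v) := by
  intro a a' b b' ha ha' hb hb' h1 h2
  rcases h b b' a a' (not_not.1 hb) (not_not.1 hb') ha ha' h1.symm h2.symm with h | h
  · exact Or.inr h.symm
  · exact Or.inl h.symm

/-- The bipartite complement of `2K₂` is again `2K₂`, with `b` and `b'` exchanged. -/
theorem IsChain2.neg {V : Type*} {x y : V → ℝ} (hx : x.Injective) (hy : y.Injective)
    {A : V → Prop} (h : IsChain2 x y A) : IsChain2 x (-y) A := by
  intro a a' b b' ha ha' hb hb' h1 h2
  have ne : ∀ {u v}, A u → ¬ A v → u ≠ v := fun hu hv e => hv (e ▸ hu)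
  rw [inverted_neg hx hy (ne ha hb)] at h1
  rw [inverted_neg hx hy (ne ha' hb')] at h2
  rw [inverted_neg hx hy (ne ha hb'), inverted_neg hx hy (ne ha' hb)]
  by_contra! hc
  exact (h a a' b' b ha ha' hb' hb hc.1 hc.2).elim h1 h2

/-! ### Drawing on rows and columns of cells -/

theorem mem_standardFigure_pos {t u : ℕ} {M : Matrix (Fin t) (Fin u) SignType} {k : Fin t}
    {l : Fin u} (hM : M k l = 1) {s : ℝ} (h0 : 0 < s) (h1 : s < 1) {q : ℝ × ℝ}
    (hq : q = (((k : ℕ) : ℝ) + s, ((l : ℕ) : ℝ) + s)) : q ∈ standardFigure M := by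
  refine ⟨k, l, Or.inl ⟨hM, 1 - s, s, by linarith, h0, by ring, ?_⟩⟩
  rw [hq]
  ext <;> simp <;> ring

theorem mem_standardFigure_neg {t u : ℕ} {M : Matrix (Fin t) (Fin u) SignType} {k : Fin t}
    {l : Fin u} (hM : M k l = -1) {s : ℝ} (h0 : 0 < s) (h1 : s < 1) {q : ℝ × ℝ}
    (hq : q = (((k : ℕ) : ℝ) + s, ((l : ℕ) : ℝ) + 1 - s)) : q ∈ standardFigure M := by
  refine ⟨k, l, Or.inr ⟨hM, 1 - s, s, by linarith, h0, by ring, ?_⟩⟩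
  rw [hq]
  ext <;> simp <;> ring

/-- The two-column matrix with one row of constant sign `e`. -/
def rowMatrix (e : SignType) : Matrix (Fin 2) (Fin 1) SignType := fun _ _ => e

/-- The two-row matrix with one column of constant sign `e`. -/
def colMatrix (e : SignType) : Matrix (Fin 1) (Fin 2) SignType := fun _ _ => e

/-- The matrix whose standard figure is an `X`. -/
def crossMatrix : Matrix (Fin 2) (Fin 2) SignType := fun k l => if k = l then 1 else -1

theorem exists_scaling {V : Type*} [Finite V] (f : V → ℝ) :
    ∃ s : V → ℝ, (∀ i, 0 < s i ∧ s i < 1) ∧ ∀ i j, f i < f j → s i < s j := by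
  obtain ⟨K, hK⟩ := (Set.finite_range fun i => |f i|).bddAbove
  have hK' : ∀ i, |f i| ≤ K := fun i => hK ⟨i, rfl⟩
  refine ⟨fun i => (f i + (|K| + 1)) / (2 * (|K| + 1)), fun i => ?_, fun i j h => ?_⟩
  · have := abs_le.1 ((hK' i).trans (le_abs_self K))
    constructor
    · apply div_pos <;> linarith [abs_nonneg K]
    · rw [div_lt_one] <;> linarith [abs_nonneg K]
  · have : 0 < 2 * (|K| + 1) := by positivity
    dsimp only
    gcongr

/-- A configuration whose points left, resp. right, of a vertical line are increasing is drawable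
on two increasing cells side by side. -/
theorem drawable_rowMatrix {V : Type*} [Finite V] {x y : V → ℝ} (c : ℝ)
    (h1 : IncreasingOn x y (fun v => x v ≤ c)) (h2 : IncreasingOn x y (fun v => c < x v)) :
    Drawable (rowMatrix 1) x y := by
  obtain ⟨s, hs, hmono⟩ := exists_scaling y
  refine ⟨fun i => ((if x i ≤ c then 0 else 1) + s i, s i), fun i => ?_, fun i j h => ?_, hmono⟩
  · by_cases hc : x i ≤ c
    · exact mem_standardFigure_pos (k := 0) (l := 0) rfl (hs i).1 (hs i).2 (by simp [hc])
    · exact mem_standardFigure_pos (k := 1) (l := 0) rfl (hs i).1 (hs i).2 (by simp [hc])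
  · have hi := hs i
    have hj := hs j
    by_cases hci : x i ≤ c <;> by_cases hcj : x j ≤ c <;> simp only [hci, hcj, if_true, if_false]
    · linarith [hmono i j (h1 i j hci hcj h)]
    · linarith
    · linarith
    · linarith [hmono i j (h2 i j (not_le.1 hci) (not_le.1 hcj) h)]

/-- A configuration whose points below, resp. above, a horizontal line are increasing is drawable
on two increasing cells on top of each other. -/
theorem drawable_colMatrix {V : Type*} [Finite V] {x y : V → ℝ} (c : ℝ)
    (h1 : IncreasingOn y x (fun v => y v < c)) (h2 : IncreasingOn y x (fun v => c ≤ y v)) :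
    Drawable (colMatrix 1) x y := by
  obtain ⟨s, hs, hmono⟩ := exists_scaling x
  refine ⟨fun i => (s i, (if y i < c then 0 else 1) + s i), fun i => ?_, hmono, fun i j h => ?_⟩
  · by_cases hc : y i < c
    · exact mem_standardFigure_pos (k := 0) (l := 0) rfl (hs i).1 (hs i).2 (by simp [hc])
    · exact mem_standardFigure_pos (k := 0) (l := 1) rfl (hs i).1 (hs i).2 (by simp [hc])
  · have hi := hs i
    have hj := hs j
    by_cases hci : y i < c <;> by_cases hcj : y j < c <;> simp only [hci, hcj, if_true, if_false]
    · linarith [hmono i j (h1 i j hci hcj h)]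
    · linarith
    · linarith
    · linarith [hmono i j (h2 i j (not_lt.1 hci) (not_lt.1 hcj) h)]

/-- Reflection in a horizontal line. -/
theorem Drawable.neg {V : Type*} {t u : ℕ} {M M' : Matrix (Fin t) (Fin u) SignType}
    {x y : V → ℝ} (h : Drawable M x (-y)) (hM : ∀ k l, M' k l.rev = - M k l) :
    Drawable M' x y := by
  obtain ⟨p, hp, h1, h2⟩ := h
  refine ⟨fun i => ((p i).1, u - (p i).2), fun i => ?_, h1, fun i j hij => ?_⟩
  · obtain ⟨k, l, ⟨hkl, a, b, ha, hb, hab, e⟩ | ⟨hkl, a, b, ha, hb, hab, e⟩⟩ := hp i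
    all_goals
      have hl : (((l.rev : Fin u) : ℕ) : ℝ) = u - (l + 1) := by
        rw [Fin.val_rev, Nat.cast_sub l.2]; push_cast; ring
      have ha' : a = 1 - b := by linarith
      subst ha'
      have hb1 : b < 1 := by linarith
    · refine mem_standardFigure_neg (k := k) (l := l.rev) (by rw [hM, hkl]) hb hb1 ?_
      simp only [← e, hl]
      ext <;> simp <;> ring
    · refine mem_standardFigure_pos (k := k) (l := l.rev) (by rw [hM, hkl]; rfl) hb hb1 ?_
      simp only [← e, hl]
      ext <;> simp <;> ring
  · have := h2 j i (by simpa using hij)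
    dsimp only
    linarith

/-! ### Two increasing sequences -/

/-- Let `a1` and `a0` be the leftmost and rightmost upper-left ends of inversions. If no point
outside `A` lies horizontally between them, the vertical line through `a0` cuts every inversion.
Otherwise the horizontal line through `a1` does, since an inversion above it would yield a `2K₂`. -/
theorem drawable_of_upperLeft_mem {V : Type*} [Finite V] {x y : V → ℝ} {A : V → Prop}
    (hA : IncreasingOn x y A)
    (hB : IncreasingOn x y (fun v => ¬ A v)) (hc : IsChain2 x y A)
    (hx : x.Injective) (hy : y.Injective)
    (hul : ∀ i j, x i < x j → y j < y i → A i ∧ ¬ A j) :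
    Drawable (rowMatrix 1) x y ∨ Drawable (colMatrix 1) x y := by
  have hlt : ∀ {i j}, ¬ (x i < x j ∧ y j < y i) → x i < x j → y i < y j := by
    intro i j h hij
    rcases lt_trichotomy (y i) (y j) with h' | h' | h'
    · exact h'
    · exact absurd (hy h') (fun e => by simp [e] at hij)
    · exact absurd ⟨hij, h'⟩ h
  have hlt' : ∀ {i j}, ¬ (x j < x i ∧ y i < y j) → y i < y j → x i < x j := by
    intro i j h hij
    rcases lt_trichotomy (x i) (x j) with h' | h' | h'
    · exact h'
    · exact absurd (hx h') (fun e => by simp [e] at hij)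
    · exact absurd ⟨h', hij⟩ h
  have hA' : ∀ i j, A i → A j → y i < y j → x i < x j := fun i j hi hj hij =>
    hlt' (fun h => lt_asymm h.2 (hA j i hj hi h.1)) hij
  have hB' : ∀ i j, ¬ A i → ¬ A j → y i < y j → x i < x j := fun i j hi hj hij =>
    hlt' (fun h => lt_asymm h.2 (hB j i hj hi h.1)) hij
  let S : Set V := {a | ∃ b, x a < x b ∧ y b < y a}
  by_cases hS : S.Nonempty
  swap
  · left
    -- Without inversions any cutting line works; `0` is arbitrary.
    refine drawable_rowMatrix 0 (fun i j _ _ h => hlt (fun h' => hS ⟨i, j, h'⟩) h)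
      (fun i j _ _ h => hlt (fun h' => hS ⟨i, j, h'⟩) h)
  obtain ⟨a0, ⟨b0, hb0⟩, hmax⟩ := S.exists_max_image x S.toFinite hS
  obtain ⟨a1, ⟨b1, hb1⟩, hmin⟩ := S.exists_min_image x S.toFinite hS
  have hA0 := hul _ _ hb0.1 hb0.2
  have hA1 := hul _ _ hb1.1 hb1.2
  have hyle : ∀ i j, A i → A j → x i ≤ x j → y i ≤ y j := by
    intro i j hi hj h
    rcases h.lt_or_eq with h | h
    · exact (hA i j hi hj h).le
    · rw [hx h]
  by_cases hbx : ∃ b, ¬ A b ∧ x a1 < x b ∧ x b < x a0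
  · right
    refine drawable_colMatrix (y a1) (fun i j hi hj h => hlt' ?_ h) (fun i j hi hj h => hlt' ?_ h)
    · rintro ⟨h1, h2⟩
      have := hyle a1 j hA1.1 (hul _ _ h1 h2).1 (hmin j ⟨i, h1, h2⟩)
      exact absurd hj this.not_gt
    · rintro ⟨h1, h2⟩
      have hji := hul _ _ h1 h2
      have h3 := hyle j a0 hji.1 hA0.1 (hmax j ⟨i, h1, h2⟩)
      have hi' : y a1 < y i := lt_of_le_of_ne hi (fun e => hji.2 (hy e ▸ hA1.1))
      obtain ⟨b, hb, hb2, hb3⟩ := hbx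
      -- The edges `a1 c` and `a0 d` will form the forbidden `2K₂`: `c` is to the lower left of
      -- `a0`, and `d` to the upper right of `a1`.
      have key1 : ∃ c, ¬ A c ∧ x a1 < x c ∧ y c < y a1 ∧ x c < x a0 := by
        rcases lt_or_ge (x b1) (x a0) with h | h
        · exact ⟨b1, hA1.2, hb1.1, hb1.2, h⟩
        · exact ⟨b, hb, hb2, (hB b b1 hb hA1.2 (hb3.trans_le h)).trans hb1.2, hb3⟩
      have key2 : ∃ c, ¬ A c ∧ x a0 < x c ∧ y c < y a0 ∧ y a1 < y c := by
        rcases lt_or_ge (y a1) (y b0) with h | h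
        · exact ⟨b0, hA0.2, hb0.1, hb0.2, h⟩
        · exact ⟨i, hji.2, hb0.1.trans (hB' b0 i hA0.2 hji.2 (h.trans_lt hi')),
            h2.trans_le h3, hi'⟩
      obtain ⟨c, hc1, hc2, hc3, hc4⟩ := key1
      obtain ⟨d, hd1, hd2, hd3, hd4⟩ := key2
      rcases hc a1 a0 c d hA1.1 hA0.1 hc1 hd1 (Or.inl ⟨hc2, hc3⟩) (Or.inl ⟨hd2, hd3⟩) with
        (h | h) | (h | h) <;> linarith [h.1, h.2]
  · left
    push Not at hbx
    refine drawable_rowMatrix (x a0) (fun i j hi hj h => hlt ?_ h) (fun i j hi hj h => hlt ?_ h)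
    · rintro ⟨h1, h2⟩
      have hij := hul _ _ h1 h2
      have h3 := hmin i ⟨j, h1, h2⟩
      have h4 := hbx j hij.2 (h3.trans_lt h1)
      exact hij.2 (hx (le_antisymm hj h4) ▸ hA0.1)
    · rintro ⟨h1, h2⟩
      exact absurd hi (hmax i ⟨j, h1, h2⟩).not_gt

theorem drawable_of_increasing_increasing {V : Type*} [Finite V] {x y : V → ℝ} {A : V → Prop}
    (hA : IncreasingOn x y A) (hB : IncreasingOn x y (fun v => ¬ A v)) (hc : IsChain2 x y A)
    (hx : x.Injective) (hy : y.Injective) :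
    Drawable (rowMatrix 1) x y ∨ Drawable (colMatrix 1) x y := by
  have hmix : ∀ i j, x i < x j → y j < y i → (A i ↔ ¬ A j) := by
    intro i j h1 h2
    constructor
    · exact fun hi hj => lt_asymm h2 (hA i j hi hj h1)
    · exact fun hj => by_contra fun hi => lt_asymm h2 (hB i j hi hj h1)
  by_cases h : ∀ i j, x i < x j → y j < y i → A i
  · exact drawable_of_upperLeft_mem hA hB hc hx hy
      fun i j h1 h2 => ⟨h i j h1 h2, (hmix i j h1 h2).1 (h i j h1 h2)⟩
  · push Not at h
    obtain ⟨b', a', hx', hy', hb'⟩ := h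
    have ha' : A a' := by_contra fun h => hb' ((hmix _ _ hx' hy').2 h)
    -- Some inversion has its upper-left end outside `A`. One of the opposite kind would form a
    -- `2K₂` with it, so the classes can swap roles.
    refine drawable_of_upperLeft_mem (A := fun v => ¬ A v) hB (by simpa using hA) hc.compl hx hy
      fun a b h1 h2 => ?_
    have hni : ¬ A a := by
      intro ha
      have hb := (hmix _ _ h1 h2).1 ha
      rcases hc a a' b b' ha ha' hb hb' (Or.inl ⟨h1, h2⟩) (Or.inr ⟨hx', hy'⟩) with
        (h | h) | (h | h)
      · exact lt_asymm (hA a a' ha ha' (h.1.trans hx')) (hy'.trans h.2)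
      · exact lt_asymm (hB b' b hb' hb (h.1.trans h1)) (h2.trans h.2)
      · exact lt_asymm (hB b' b hb' hb (hx'.trans h.1)) (h.2.trans hy')
      · exact lt_asymm (hA a a' ha ha' (h1.trans h.1)) (h.2.trans h2)
    exact ⟨hni, fun hb => hb (by_contra fun hb' => hni ((hmix _ _ h1 h2).2 hb'))⟩

/-! ### An increasing and a decreasing sequence -/

/-- Drawing on an `X` by means of a distance `d` from its centre. -/
theorem drawable_crossMatrix {V : Type*} [Finite V] {x y : V → ℝ} {L T : V → Prop} (d : V → ℝ)
    (hL : ∀ i j, x i < x j → L j → L i) (hT : ∀ i j, y i < y j → T i → T j)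
    (h1 : ∀ i j, L i → L j → x i < x j → d j < d i)
    (h2 : ∀ i j, ¬ L i → ¬ L j → x i < x j → d i < d j)
    (h3 : ∀ i j, ¬ T i → ¬ T j → y i < y j → d j < d i)
    (h4 : ∀ i j, T i → T j → y i < y j → d i < d j) :
    Drawable crossMatrix x y := by
  classical
  obtain ⟨s, hs, hm⟩ := exists_scaling d
  refine ⟨fun i => (if L i then 1 - s i else 1 + s i, if T i then 1 + s i else 1 - s i),
    fun i => ?_, fun i j h => ?_, fun i j h => ?_⟩
  · have hi := hs i
    by_cases hl : L i <;> by_cases ht : T i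
    · refine mem_standardFigure_neg (k := 0) (l := 1) (s := 1 - s i) rfl (by linarith)
        (by linarith) ?_
      simp only [hl, ht, if_true]
      ext <;> simp
    · exact mem_standardFigure_pos (k := 0) (l := 0) (s := 1 - s i) rfl (by linarith)
        (by linarith) (by simp [hl, ht])
    · exact mem_standardFigure_pos (k := 1) (l := 1) rfl hi.1 hi.2 (by simp [hl, ht])
    · exact mem_standardFigure_neg (k := 1) (l := 0) rfl hi.1 hi.2 (by simp [hl, ht])
  · have hi := hs i
    have hj := hs j
    by_cases hli : L i <;> by_cases hlj : L j <;> simp only [hli, hlj, if_true, if_false]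
    · linarith [hm _ _ (h1 i j hli hlj h)]
    · linarith
    · exact absurd (hL i j h hlj) hli
    · linarith [hm _ _ (h2 i j hli hlj h)]
  · have hi := hs i
    have hj := hs j
    by_cases hli : T i <;> by_cases hlj : T j <;> simp only [hli, hlj, if_true, if_false]
    · linarith [hm _ _ (h4 i j hli hlj h)]
    · exact absurd (hT i j h hli) hlj
    · linarith
    · linarith [hm _ _ (h3 i j hli hlj h)]

/-- In a bipartite chain graph, a key on the vertices that compares each vertex with those of
the other side according to adjacency, and is monotone with respect to neighbourhoods. -/
theorem exists_chain_key {V : Type*} [Finite V] {R : V → V → Prop} {A : V → Prop}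
    (hc : ∀ a a' b b', A a → A a' → ¬ A b → ¬ A b' → R a b → R a' b' → R a b' ∨ R a' b) :
    ∃ k : V → ℕ, (∀ a b, A a → ¬ A b → R a b → k a < k b) ∧
      (∀ a b, A a → ¬ A b → ¬ R a b → k b < k a) ∧
      (∀ a a', A a → A a' → (∀ b, ¬ A b → R a' b → R a b) → k a ≤ k a') ∧
      (∀ b b', ¬ A b → ¬ A b' → (∀ a, A a → R a b → R a b') → k b ≤ k b') := by
  classical
  have := Fintype.ofFinite V
  let I : V → Finset V := fun a => Finset.univ.filter fun b => ¬ A b ∧ ¬ R a b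
  let N : V → Finset V := fun b => Finset.univ.filter fun a => A a ∧ R a b
  let m : V → ℕ := fun b => (N b).sup fun a => (I a).card
  -- The non-neighbourhoods `I a` are nested, so their sizes order `A`; each `b` goes just after its
  -- last neighbour, the odd values keeping the two sides apart.
  refine ⟨fun v => if A v then 2 * (I v).card else 2 * m v + 1, ?_, ?_, ?_, ?_⟩
  · intro a b ha hb h
    have : (I a).card ≤ m b := Finset.le_sup (f := fun a => (I a).card) (by simp [N, ha, h])
    simp only [ha, hb, if_true, if_false]
    omega
  · intro a b ha hb h
    have : m b < (I a).card := by
      refine (Finset.sup_lt_iff ?_).2 fun a' ha' => ?_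
      -- Positivity is needed because the supremum defaults to `0` when `b` has no neighbours.
      · exact Finset.card_pos.2 ⟨b, by simp [I, hb, h]⟩
      · simp only [N, Finset.mem_filter, Finset.mem_univ, true_and] at ha'
        apply Finset.card_lt_card
        refine Finset.ssubset_iff_subset_ne.2 ⟨fun c hcm => ?_, fun e => ?_⟩
        · simp only [I, Finset.mem_filter, Finset.mem_univ, true_and] at hcm ⊢
          refine ⟨hcm.1, fun hac => ?_⟩
          exact (hc a a' c b ha ha'.1 hcm.1 hb hac ha'.2).elim h hcm.2
        · have hb' : b ∈ I a' := e ▸ (by simp [I, hb, h])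
          simp only [I, Finset.mem_filter, Finset.mem_univ, true_and] at hb'
          exact hb'.2 ha'.2
    simp only [ha, hb, if_true, if_false]
    omega
  · intro a a' ha ha' h
    have : (I a).card ≤ (I a').card := Finset.card_le_card fun c hcm => by
      simp only [I, Finset.mem_filter, Finset.mem_univ, true_and] at hcm ⊢
      exact ⟨hcm.1, fun h' => hcm.2 (h c hcm.1 h')⟩
    simp only [ha, ha', if_true]
    omega
  · intro b b' hb hb' h
    have : m b ≤ m b' := Finset.sup_mono fun c hcm => by
      simp only [N, Finset.mem_filter, Finset.mem_univ, true_and] at hcm ⊢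
      exact ⟨hcm.1, h c hcm.1 hcm.2⟩
    simp only [hb, hb', if_false]
    omega

/-- In a nonempty bipartite chain graph, one side has a dominating vertex or the other has an
isolated one. -/
theorem exists_dominating_or_isolated {V : Type*} [Finite V] [Nonempty V] {R : V → V → Prop}
    {A : V → Prop}
    (hc : ∀ a a' b b', A a → A a' → ¬ A b → ¬ A b' → R a b → R a' b' → R a b' ∨ R a' b) :
    (∃ a, A a ∧ ∀ b, ¬ A b → R a b) ∨ (∃ b, ¬ A b ∧ ∀ a, A a → ¬ R a b) := by
  obtain ⟨k, h1, h2, -, -⟩ := exists_chain_key hc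
  obtain ⟨v, hv⟩ := Finite.exists_min k
  by_cases hA : A v
  · exact Or.inl ⟨v, hA, fun b hb => by_contra fun h => (h2 v b hA hb h).not_ge (hv b)⟩
  · exact Or.inr ⟨v, hA, fun a ha h => (h1 a v ha hA h).not_ge (hv a)⟩

/-- An increasing and a decreasing sequence that cross at a centre. -/
theorem drawable_of_centre {V : Type*} [Finite V] {x y : V → ℝ} {A L T : V → Prop}
    (hx : x.Injective) (hy : y.Injective)
    (hA : IncreasingOn x y A) (hB : IncreasingOn x (-y) (fun v => ¬ A v)) (hc : IsChain2 x y A)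
    (hL : ∀ i j, x i < x j → L j → L i) (hT : ∀ i j, y i < y j → T i → T j)
    (hLA : ∀ v, A v → (L v ↔ ¬ T v)) (hLB : ∀ v, ¬ A v → (L v ↔ T v)) :
    Drawable crossMatrix x y := by
  classical
  have hLlt : ∀ {i j}, L i → ¬ L j → x i < x j := fun {i j} hi hj =>
    lt_of_le_of_ne (not_lt.1 fun h => hj (hL _ _ h hi)) fun e => hj (hx e ▸ hi)
  have hTlt : ∀ {i j}, ¬ T i → T j → y i < y j := fun {i j} hi hj =>
    lt_of_le_of_ne (not_lt.1 fun h => hi (hT _ _ h hj)) fun e => hi (hy e ▸ hj)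
  -- In each pair of adjacent quadrants one coordinate order is forced, and inversion says that `a`
  -- is nearer the centre than `b`.
  have r1 : ∀ {a b}, A a → ¬ A b → L a → L b → (Inverted x y a b ↔ x b < x a) :=
    fun {a b} ha hb hla hlb => by
      have := hTlt ((hLA a ha).1 hla) ((hLB b hb).1 hlb)
      simp [Inverted, this, this.not_gt]
  have r2 : ∀ {a b}, A a → ¬ A b → ¬ L a → L b → (Inverted x y a b ↔ y a < y b) :=
    fun {a b} ha hb hla hlb => by
      have := hLlt hlb hla
      simp [Inverted, this, this.not_gt]
  have r3 : ∀ {a b}, A a → ¬ A b → L a → ¬ L b → (Inverted x y a b ↔ y b < y a) :=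
    fun {a b} ha hb hla hlb => by
      have := hLlt hla hlb
      simp [Inverted, this, this.not_gt]
  have r4 : ∀ {a b}, A a → ¬ A b → ¬ L a → ¬ L b → (Inverted x y a b ↔ x a < x b) :=
    fun {a b} ha hb hla hlb => by
      have := hTlt (mt (hLB b hb).2 hlb) (not_not.1 (mt (hLA a ha).2 hla))
      simp [Inverted, this, this.not_gt]
  replace hB : ∀ i j, ¬ A i → ¬ A j → x i < x j → y j < y i :=
    fun i j hi hj hij => neg_lt_neg_iff.1 (hB i j hi hj hij)
  obtain ⟨k, k1, k2, k3, k4⟩ := exists_chain_key hc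
  have kL : ∀ u v, (A u ↔ A v) → L u → L v → x u < x v → k v ≤ k u := by
    intro u v huv hu hv h
    by_cases hAu : A u
    · have hAv := huv.1 hAu
      refine k3 v u hAv hAu fun b hb hub => ?_
      by_cases hlb : L b
      · rw [r1 hAu hb hu hlb] at hub
        exact (r1 hAv hb hv hlb).2 (hub.trans h)
      · rw [r3 hAu hb hu hlb] at hub
        exact (r3 hAv hb hv hlb).2 (hub.trans (hA u v hAu hAv h))
    · have hAv := mt huv.2 hAu
      refine k4 v u hAv hAu fun a ha hav => ?_
      by_cases hla : L a
      · rw [r1 ha hAv hla hv] at hav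
        exact (r1 ha hAu hla hu).2 (h.trans hav)
      · rw [r2 ha hAv hla hv] at hav
        exact (r2 ha hAu hla hu).2 (hav.trans (hB u v hAu hAv h))
  have kR : ∀ u v, (A u ↔ A v) → ¬ L u → ¬ L v → x u < x v → k u ≤ k v := by
    intro u v huv hu hv h
    by_cases hAu : A u
    · have hAv := huv.1 hAu
      refine k3 u v hAu hAv fun b hb hvb => ?_
      by_cases hlb : L b
      · rw [r2 hAv hb hv hlb] at hvb
        exact (r2 hAu hb hu hlb).2 ((hA u v hAu hAv h).trans hvb)
      · rw [r4 hAv hb hv hlb] at hvb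
        exact (r4 hAu hb hu hlb).2 (h.trans hvb)
    · have hAv := mt huv.2 hAu
      refine k4 u v hAu hAv fun a ha hau => ?_
      by_cases hla : L a
      · rw [r3 ha hAu hla hu] at hau
        exact (r3 ha hAv hla hv).2 ((hB u v hAu hAv h).trans hau)
      · rw [r4 ha hAu hla hu] at hau
        exact (r4 ha hAv hla hv).2 (hau.trans h)
  -- The distance will be `k + s`: the integer key settles comparisons between the sequences, and
  -- the fractional part, growing away from the centre line, breaks ties within one.
  obtain ⟨s, hs, hm⟩ := exists_scaling fun v => if L v then -x v else x v
  have lt1 : ∀ {u v}, k u < k v → (k u : ℝ) + s u < k v + s v := fun {u v} h => by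
    have : (k u : ℝ) + 1 ≤ k v := by exact_mod_cast h
    linarith [(hs u).2, (hs v).1]
  have lt2 : ∀ {u v}, k u ≤ k v → s u < s v → (k u : ℝ) + s u < k v + s v := fun {u v} h h' => by
    have : (k u : ℝ) ≤ k v := by exact_mod_cast h
    linarith
  have dL : ∀ u v, (A u ↔ A v) → L u → L v → x u < x v → (k v : ℝ) + s v < k u + s u :=
    fun u v huv hu hv h => lt2 (kL u v huv hu hv h) (hm v u (by simpa [hu, hv] using h))
  have dR : ∀ u v, (A u ↔ A v) → ¬ L u → ¬ L v → x u < x v → (k u : ℝ) + s u < k v + s v :=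
    fun u v huv hu hv h => lt2 (kR u v huv hu hv h) (hm u v (by simpa [hu, hv] using h))
  have hA' : ∀ i j, A i → A j → y i < y j → x i < x j := fun i j hi hj h => by
    rcases lt_trichotomy (x i) (x j) with h' | h' | h'
    · exact h'
    · simp [hx h'] at h
    · exact absurd h (hA j i hj hi h').not_gt
  have hB' : ∀ i j, ¬ A i → ¬ A j → y i < y j → x j < x i := fun i j hi hj h => by
    rcases lt_trichotomy (x i) (x j) with h' | h' | h'
    · exact absurd h (hB i j hi hj h').not_gt
    · simp [hx h'] at h
    · exact h'
  refine drawable_crossMatrix (fun v => (k v : ℝ) + s v) hL hT ?_ ?_ ?_ ?_ <;> intro i j hi hj h <;>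
    by_cases hAi : A i <;> by_cases hAj : A j
  · exact dL i j (iff_of_true hAi hAj) hi hj h
  · exact lt1 (k2 i j hAi hAj (mt (r1 hAi hAj hi hj).1 h.not_gt))
  · exact lt1 (k1 j i hAj hAi ((r1 hAj hAi hj hi).2 h))
  · exact dL i j (iff_of_false hAi hAj) hi hj h
  · exact dR i j (iff_of_true hAi hAj) hi hj h
  · exact lt1 (k1 i j hAi hAj ((r4 hAi hAj hi hj).2 h))
  · exact lt1 (k2 j i hAj hAi (mt (r4 hAj hAi hj hi).1 h.not_gt))
  · exact dR i j (iff_of_false hAi hAj) hi hj h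
  · exact dL i j (iff_of_true hAi hAj) ((hLA i hAi).2 hi) ((hLA j hAj).2 hj) (hA' i j hAi hAj h)
  · exact lt1 (k2 i j hAi hAj
      (mt (r3 hAi hAj ((hLA i hAi).2 hi) (mt (hLB j hAj).1 hj)).1 h.not_gt))
  · exact lt1 (k1 j i hAj hAi ((r3 hAj hAi ((hLA j hAj).2 hj) (mt (hLB i hAi).1 hi)).2 h))
  · exact dR j i (iff_of_false hAj hAi) (mt (hLB j hAj).1 hj) (mt (hLB i hAi).1 hi)
      (hB' i j hAi hAj h)
  · exact dR i j (iff_of_true hAi hAj) (fun hl => (hLA i hAi).1 hl hi)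
      (fun hl => (hLA j hAj).1 hl hj) (hA' i j hAi hAj h)
  · exact lt1 (k1 i j hAi hAj
      ((r2 hAi hAj (fun hl => (hLA i hAi).1 hl hi) ((hLB j hAj).2 hj)).2 h))
  · exact lt1 (k2 j i hAj hAi
      (mt (r2 hAj hAi (fun hl => (hLA j hAj).1 hl hj) ((hLB i hAi).2 hi)).1 h.not_gt))
  · exact dL j i (iff_of_false hAj hAi) ((hLB j hAj).2 hj) ((hLB i hAi).2 hi)
      (hB' i j hAi hAj h)

theorem drawable_of_increasing_decreasing {V : Type*} [Finite V] {x y : V → ℝ} {A : V → Prop}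
    (hx : x.Injective) (hy : y.Injective)
    (hA : IncreasingOn x y A) (hB : IncreasingOn x (-y) (fun v => ¬ A v))
    (hc : IsChain2 x y A) : Drawable crossMatrix x y := by
  rcases isEmpty_or_nonempty V with hV | hV
  · exact ⟨isEmptyElim, isEmptyElim, isEmptyElim, isEmptyElim⟩
  rcases exists_dominating_or_isolated hc with ⟨c, hcA, h⟩ | ⟨c, hcB, h⟩
  -- The strict inequality in `T` puts `c` itself in the lower left quadrant, as a point of `A`
  -- requires; for an isolated `c` outside `A` the weak one puts it in the upper left.
  · refine drawable_of_centre (L := fun v => x v ≤ x c) (T := fun v => y c < y v) hx hy hA hB hc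
      (fun i j hij hj => hij.le.trans hj) (fun i j hij hi => hi.trans hij)
      (fun v hv => ?_) (fun v hv => ?_)
    · rcases lt_trichotomy (x v) (x c) with hvc | hvc | hvc
      · simp [hvc.le, (hA v c hv hcA hvc).le]
      · simp [hx hvc]
      · simp [hvc, hA c v hcA hv hvc]
    · rcases h v hv with h | h
      · exact iff_of_false h.1.not_ge h.2.not_gt
      · exact iff_of_true h.1.le h.2
  · refine drawable_of_centre (L := fun v => x v ≤ x c) (T := fun v => y c ≤ y v) hx hy hA hB hc
      (fun i j hij hj => hij.le.trans hj) (fun i j hij hi => hi.trans hij.le)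
      (fun v hv => ?_) (fun v hv => ?_)
    · have hne : v ≠ c := fun e => hcB (e ▸ hv)
      have h := h v hv
      simp only [Inverted, not_or, not_and, not_lt] at h
      rcases lt_or_gt_of_ne (hx.ne hne) with hvc | hvc
      · have := lt_of_le_of_ne (h.1 hvc) (hy.ne hne)
        simp [hvc.le, this]
      · simp [hvc, h.2 hvc]
    · rcases lt_trichotomy (x v) (x c) with hvc | hvc | hvc
      · have := neg_lt_neg_iff.1 (hB v c hv hcB hvc)
        simp [hvc.le, this.le]
      · simp [hx hvc]
      · have := neg_lt_neg_iff.1 (hB c v hcB hv hvc)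
        exact iff_of_false hvc.not_ge this.not_ge

/-- Any configuration split into two monotone sequences whose bipartite inversion graph is a
chain graph is drawable on one of five figures. -/
theorem drawable_of_chain {V : Type*} [Finite V] {x y : V → ℝ} {A : V → Prop}
    (hx : x.Injective) (hy : y.Injective)
    (hA : IncreasingOn x y A ∨ IncreasingOn x (-y) A)
    (hB : IncreasingOn x y (fun v => ¬ A v) ∨ IncreasingOn x (-y) (fun v => ¬ A v))
    (hc : IsChain2 x y A) :
    Drawable crossMatrix x y ∨ ∃ e : SignType,
      Drawable (rowMatrix e) x y ∨ Drawable (colMatrix e) x y := by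
  rcases hA with hA | hA <;> rcases hB with hB | hB
  · exact Or.inr ⟨1, drawable_of_increasing_increasing hA hB hc hx hy⟩
  · exact Or.inl (drawable_of_increasing_decreasing hx hy hA hB hc)
  · exact Or.inl (drawable_of_increasing_decreasing (A := fun v => ¬ A v) hx hy hB
      (by simpa using hA) hc.compl)
  · refine Or.inr ⟨-1, ?_⟩
    have hy' : (-y).Injective := neg_injective.comp hy
    exact (drawable_of_increasing_increasing hA hB (hc.neg hx hy) hx hy').imp
      (fun h => h.neg fun _ _ => rfl) (fun h => h.neg fun _ _ => rfl)

/-! ### From letter graphs to configurations -/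

theorem permGraph_adj_iff {n : ℕ} (π : Equiv.Perm (Fin n)) (i j : Fin n) :
    (permGraph π).Adj i j ↔
      Inverted (fun i : Fin n => ((i : ℕ) : ℝ)) (fun i : Fin n => ((π i : ℕ) : ℝ)) i j := by
  simp only [permGraph, Inverted, mul_neg_iff, sub_pos, sub_neg, Nat.cast_lt]
  tauto

theorem IsLetterGraphOn.mono {k l n : ℕ} (h : k ≤ l) {G : SimpleGraph (Fin n)}
    (hG : IsLetterGraphOn k G) : IsLetterGraphOn l G := by
  obtain ⟨P, w, ⟨e⟩⟩ := hG
  refine ⟨{p | ∃ q ∈ P, Fin.castLE h q.1 = p.1 ∧ Fin.castLE h q.2 = p.2},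
    fun i => Fin.castLE h (w i), ⟨⟨e.toEquiv, fun {a b} => ?_⟩⟩⟩
  rw [← e.map_adj_iff]
  simp [letterGraph]

theorem IsKLetterGraph.isLetterGraphOn {k n : ℕ} {G : SimpleGraph (Fin n)}
    (h : IsKLetterGraph k G) : IsLetterGraphOn k G :=
  IsLetterGraphOn.mono h (Nat.sInf_mem (s := {l : ℕ | IsLetterGraphOn l G})
    ⟨n, isLetterGraphOn_card G⟩)

/-- A two-letter graph splits into two homogeneous parts joined by a chain graph. -/
theorem IsLetterGraphOn.exists_split {n : ℕ} {G : SimpleGraph (Fin n)}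
    (h : IsLetterGraphOn 2 G) : ∃ A : Fin n → Prop,
      ((∀ i j, A i → A j → ¬ G.Adj i j) ∨ (∀ i j, A i → A j → i ≠ j → G.Adj i j)) ∧
      ((∀ i j, ¬ A i → ¬ A j → ¬ G.Adj i j) ∨ (∀ i j, ¬ A i → ¬ A j → i ≠ j → G.Adj i j)) ∧
      ∀ a a' b b', A a → A a' → ¬ A b → ¬ A b' → G.Adj a b → G.Adj a' b' →
        G.Adj a b' ∨ G.Adj a' b := by
  obtain ⟨P, w, ⟨e⟩⟩ := h
  have hw : ∀ i, w i ≠ 0 ↔ w i = 1 := fun i => by omega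
  have hom : ∀ c : Fin 2, (∀ i j, w (e i) = c → w (e j) = c → ¬ G.Adj i j) ∨
      (∀ i j, w (e i) = c → w (e j) = c → i ≠ j → G.Adj i j) := by
    intro c
    by_cases hP : (c, c) ∈ P
    · right
      intro i j hi hj hij
      rw [← e.map_adj_iff]
      have := e.injective.ne hij
      rcases lt_or_gt_of_ne this with h | h
      · exact Or.inl ⟨h, by rwa [hi, hj]⟩
      · exact Or.inr ⟨h, by rwa [hi, hj]⟩
    · left
      intro i j hi hj
      rw [← e.map_adj_iff]
      rintro (h | h) <;> rw [hi, hj] at h <;> exact hP h.2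
  refine ⟨fun i => w (e i) = 0, hom 0, ?_, ?_⟩
  · simpa only [← ne_eq, hw] using hom 1
  · intro a a' b b' ha ha' hb hb'
    replace hb := (hw (e b)).1 hb
    replace hb' := (hw (e b')).1 hb'
    have adj : ∀ i j, G.Adj i j ↔ (e i < e j ∧ (w (e i), w (e j)) ∈ P) ∨
        (e j < e i ∧ (w (e j), w (e i)) ∈ P) := fun i j => e.map_adj_iff.symm
    simp only [adj, ha, ha', hb, hb']
    have n1 : e a ≠ e b' := fun h => by rw [h, hb'] at ha; omega
    have n2 : e a' ≠ e b := fun h => by rw [h, hb] at ha'; omega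
    -- The graph between the letters is complete, empty, or a comparison of positions; in the last
    -- case, if `a < b` and `a' < b'`, the smaller of `a`, `a'` precedes both `b` and `b'`.
    by_cases p1 : ((0 : Fin 2), (1 : Fin 2)) ∈ P <;> by_cases p2 : ((1 : Fin 2), (0 : Fin 2)) ∈ P <;>
      simp only [p1, p2, and_true, and_false, or_false, false_or] <;> grind

theorem mem_Geom_of_drawable {t u : ℕ} {M : Matrix (Fin t) (Fin u) SignType} {σ : FinPerm}
    (h : Drawable M (fun i : Fin σ.1 => ((i : ℕ) : ℝ))
      (fun i : Fin σ.1 => ((σ.2 i : ℕ) : ℝ))) :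
    σ ∈ Geom M := by
  obtain ⟨p, hp, h1, h2⟩ := h
  refine ⟨p, hp, fun i j hij => h1 i j (Nat.cast_lt.2 hij), fun i j hij => h2 _ _ ?_⟩
  simpa using hij

theorem theorem4 (X : Set FinPerm)
    (hX : ∀ G ∈ permGraphClass X, IsKLetterGraph 2 G.2) :
    GeometricallyGriddable X := by
  let r (e : SignType) : (d : ℕ × ℕ) × Matrix (Fin d.1) (Fin d.2) SignType := ⟨(2, 1), rowMatrix e⟩
  let c (e : SignType) : (d : ℕ × ℕ) × Matrix (Fin d.1) (Fin d.2) SignType := ⟨(1, 2), colMatrix e⟩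
  refine ⟨{⟨(2, 2), crossMatrix⟩} ∪ (Set.range r ∪ Set.range c),
    (Set.finite_singleton _).union ((Set.finite_range r).union (Set.finite_range c)),
    fun σ hσ => ?_⟩
  obtain ⟨A, hA, hB, hc⟩ := (hX ⟨σ.1, permGraph σ.2⟩ ⟨σ, hσ, ⟨SimpleGraph.Iso.refl⟩⟩)
    |>.isLetterGraphOn.exists_split
  simp only [permGraph_adj_iff] at hA hB hc
  have hx : (fun i : Fin σ.1 => ((i : ℕ) : ℝ)).Injective :=
    Nat.cast_injective.comp Fin.val_injective
  have hy : (fun i : Fin σ.1 => ((σ.2 i : ℕ) : ℝ)).Injective := hx.comp σ.2.injective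
  set x := fun i : Fin σ.1 => ((i : ℕ) : ℝ)
  set y := fun i : Fin σ.1 => ((σ.2 i : ℕ) : ℝ)
  have mono : ∀ B : Fin σ.1 → Prop, ((∀ i j, B i → B j → ¬ Inverted x y i j) ∨
      (∀ i j, B i → B j → i ≠ j → Inverted x y i j)) →
      IncreasingOn x y B ∨ IncreasingOn x (-y) B := by
    intro B hB
    refine hB.imp (fun h i j hi hj hij => ?_) (fun h i j hi hj hij => ?_)
    · have hne : i ≠ j := fun e => by simp [e] at hij
      rcases lt_or_gt_of_ne (hy.ne hne) with h' | h'
      · exact h'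
      · exact absurd (Or.inl ⟨hij, h'⟩) (h i j hi hj)
    · have hne : i ≠ j := fun e => by simp [e] at hij
      rcases h i j hi hj hne with h' | h'
      · exact neg_lt_neg h'.2
      · exact absurd hij h'.1.not_gt
  simp only [Set.mem_iUnion]
  rcases drawable_of_chain hx hy (mono A hA) (mono _ hB) hc with h | ⟨e, h | h⟩
  · exact ⟨_, Or.inl rfl, mem_Geom_of_drawable h⟩
  · exact ⟨_, Or.inr (Or.inl ⟨e, rfl⟩), mem_Geom_of_drawable h⟩
  · exact ⟨_, Or.inr (Or.inr ⟨e, rfl⟩), mem_Geom_of_drawable h⟩
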